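/- **Theorem 1.1.** Let $G$ be a compact abelian topological group with normalized Haar measure $\mathrm m$, let $C(G)$ be the Banach space of continuous functions $G\to\mathbb C$ with the supremum norm, and let $E$ be a finite set of continuous characters $\gamma\colon G\to\{z\in\mathbb C:|z|=1\}$. Let $\mathrm{Trig}_E(G)\subset C(G)$ be the linear span of $E$, with the supremum norm. For $f\in C(G)$ put $\widehat f(\gamma)=\int_G f(a)\overline{\gamma(a)}\,d\mathrm m(a)$, and for $a\in G$ let $T_a f(b)=f(ab)$. Define $\Pi\colon C(G)\to C(G)$ by $$\Pi f=\sum_{\gamma\in E}\widehat f(\gamma)\,\gamma .$$ For a subspace $X$ of a complex Banach space $Y$ let $\boldsymbol\lambda(X,Y)\in[0,\infty]$ be the infimum of the norms of all bounded linear projections of $Y$ onto $X$ (with $\inf\emptyset=\infty$). For a complex Banach space $X$ let $\boldsymbol\lambda(X)$ be the supremum of $\boldsymbol\lambda(I(X),Y)$ over all complex Banach spaces $Y$ and all linear isometric embeddings $I\colon X\to Y$ such that $I(X)$ is complemented in $Y$. Then $\Pi$ is a bounded linear projection of $C(G)$ onto $\mathrm{Trig}_E(G)$ which commutes with all $T_a$,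 $a\in G$, and it is the only bounded linear projection of $C(G)$ onto $\mathrm{Trig}_E(G)$ with this property. Moreover, $\Pi$ is minimal: $$\boldsymbol\lambda\big(\mathrm{Trig}_E(G),C(G)\big)=\boldsymbol\lambda\big(\mathrm{Trig}_E(G)\big)=\big\|\Pi\colon C(G)\to C(G)\big\|=\int_G\Big|\sum_{\gamma\in E}\gamma(a)\Big|\,d\mathrm m(a).$$ -/

import Mathlib

open MeasureTheory
open scoped ENNReal ComplexConjugate

universe w u

noncomputable section

/-- The relative projection constant `λ(X, Y)` of a subspace `X` of a complex normed space `Y`: the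
infimum of the norms of all bounded linear projections of `Y` onto `X`, with `inf ∅ = ∞`. -/
def relProjConst {Y : Type*} [NormedAddCommGroup Y] [NormedSpace ℂ Y] (X : Submodule ℂ Y) : ℝ≥0∞ :=
  ⨅ (P : Y →L[ℂ] X) (_ : ∀ x : X, P (x : Y) = x), ENNReal.ofReal ‖P‖

/-- The (absolute) projection constant `λ(X)` of a complex normed space `X`: the supremum of
`λ(I(X), Y)` over all complex Banach spaces `Y` (in the universe `w`, which is arbitrary) and all
linear isometric embeddings `I : X → Y` with `I(X)` complemented in `Y`. -/
def projConst (X : Type u) [NormedAddCommGroup X] [NormedSpace ℂ X] : ℝ≥0∞ :=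
  ⨆ (Y : Type w) (_ : NormedAddCommGroup Y) (_ : NormedSpace ℂ Y) (_ : CompleteSpace Y)
    (I : X →ₗᵢ[ℂ] Y) (_ : (LinearMap.range I.toLinearMap).ClosedComplemented),
    relProjConst (LinearMap.range I.toLinearMap)

section Group

variable {G : Type u} [CommGroup G] [TopologicalSpace G]

/-- A continuous character, viewed as an element of `C(G)`. -/
def charFun (γ : PontryaginDual G) : C(G, ℂ) where
  toFun a := (γ a : ℂ)
  continuous_toFun := continuous_subtype_val.comp (map_continuous γ)

/-- `Trig_E(G)`, the span of `E` in `C(G)`. As a subspace of `C(G)` it carries the sup norm. -/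
def trigPoly (E : Finset (PontryaginDual G)) : Submodule ℂ C(G, ℂ) :=
  Submodule.span ℂ (charFun '' (E : Set (PontryaginDual G)))

/-- The action of `G` on `C(G)` by translation, `(T_a f)(b) = f (a b)`. -/
def translateFun [IsTopologicalGroup G] (a : G) (f : C(G, ℂ)) : C(G, ℂ) where
  toFun b := f (a * b)
  continuous_toFun := f.continuous.comp (continuous_const_mul a)

variable [MeasurableSpace G]

/-- The Fourier coefficient `∫ f(a) conj(γ(a)) dm(a)` of `f` at the character `γ`. -/
def fourierAt (m : Measure G) (f : G → ℂ) (γ : PontryaginDual G) : ℂ :=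
  ∫ a, f a * conj (γ a : ℂ) ∂m

variable [BorelSpace G] [CompactSpace G]

theorem integrable_mul_conj (m : Measure G) [IsFiniteMeasure m] (f : C(G, ℂ))
    (γ : PontryaginDual G) : Integrable (fun a => f a * conj (γ a : ℂ)) m := by
  have hc : Continuous (fun a => f a * conj (γ a : ℂ)) :=
    f.continuous.mul (Complex.continuous_conj.comp (charFun γ).continuous)
  refine Integrable.of_bound hc.aestronglyMeasurable ‖f‖ (Filter.Eventually.of_forall fun a => ?_)
  rw [norm_mul, RCLike.norm_conj, Circle.norm_coe, mul_one]
  exact f.norm_coe_le_norm a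

theorem norm_fourierAt_le (m : Measure G) [IsFiniteMeasure m] (f : C(G, ℂ))
    (γ : PontryaginDual G) : ‖fourierAt m f γ‖ ≤ ‖f‖ * m.real Set.univ := by
  refine norm_integral_le_of_norm_le_const (Filter.Eventually.of_forall fun a => ?_)
  rw [norm_mul, RCLike.norm_conj, Circle.norm_coe, mul_one]
  exact f.norm_coe_le_norm a

/-- The Fourier projection `Π f = ∑ γ ∈ E, f̂(γ) γ`, as a bounded operator on `C(G)`. -/
def fourierProj (m : Measure G) [IsFiniteMeasure m] (E : Finset (PontryaginDual G)) :
    C(G, ℂ) →L[ℂ] C(G, ℂ) :=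
  LinearMap.mkContinuous
    { toFun := fun f => ∑ γ ∈ E, fourierAt m f γ • charFun γ
      map_add' := fun f g => by
        rw [← Finset.sum_add_distrib]
        refine Finset.sum_congr rfl fun γ _ => ?_
        rw [← add_smul]
        congr 1
        unfold fourierAt
        rw [← integral_add (integrable_mul_conj m f γ) (integrable_mul_conj m g γ)]
        simp [add_mul]
      map_smul' := fun c f => by
        rw [Finset.smul_sum]
        refine Finset.sum_congr rfl fun γ _ => ?_
        rw [RingHom.id_apply, smul_smul]
        congr 1
        unfold fourierAt
        rw [← integral_const_mul]
        simp [mul_assoc] }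
    (∑ γ ∈ E, m.real Set.univ * ‖charFun γ‖)
    (fun f => by
      rw [Finset.sum_mul]
      refine (norm_sum_le _ _).trans (Finset.sum_le_sum fun γ _ => ?_)
      rw [norm_smul]
      calc ‖fourierAt m f γ‖ * ‖charFun γ‖ ≤ (‖f‖ * m.real Set.univ) * ‖charFun γ‖ :=
            mul_le_mul_of_nonneg_right (norm_fourierAt_le m f γ) (norm_nonneg _)
        _ = m.real Set.univ * ‖charFun γ‖ * ‖f‖ := by ring)

theorem fourierProj_apply (m : Measure G) [IsFiniteMeasure m] (E : Finset (PontryaginDual G))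
    (f : C(G, ℂ)) : fourierProj m E f = ∑ γ ∈ E, fourierAt m f γ • charFun γ := rfl

end Group

end

/-! The upper bounds come from extending `Π` to all bounded functions. By Hahn–Banach the Haar
integral extends from `C(G)` to a functional of norm one on `ℓ^∞(G)`; inserting it in the formula
for `Π` gives an operator `R : ℓ^∞(G) → Trig_E(G)` which restricts to the identity on `Trig_E(G)`.
A unital norm-one functional is monotone on moduli (`norm_apply_le_re_of_norm_le`), so the norm of
`R` is at most `∫ |∑ γ|`. Since `ℓ^∞(G)` is injective, an isometric copy of `Trig_E(G)` in any `Y`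
is the range of a projection of `Y` of norm at most `‖R‖` (`projConst_le_of_retract`). The reverse
inequality `∫ |∑ γ| ≤ ‖Π‖` follows by testing `Π` on regularized phases of `∑ γ`.

The lower bounds and uniqueness come from averaging: if `P` is any bounded projection of `C(G)` onto
`Trig_E(G)`, then `Π f(b) = ∫ (P T_a f)(a⁻¹ b) dm(a)` (`fourierProj_eq_average`). This holds because
the `γ`-coefficient of `P T_a f` is a bounded functional of `T_a f`, and the vector-valued integral
of `conj γ(a) T_a f` is exactly the `γ`-component of `f`. Hence `‖Π‖ ≤ ‖P‖`, with `P = Π` if `P`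
commutes with translations; density of trigonometric polynomials in `C(G)` is not needed.

Finally `λ(X, V) ≤ λ(X)` for finite-dimensional `X` even if the spaces `Y` in the definition of
`λ(X)` range over a universe too small to contain `V`: take for `Y` a copy of the injective space
`ℓ^∞(ℕ)`, in which `X` embeds isometrically because it is separable (`relProjConst_le_projConst`). -/

set_option linter.unusedSectionVars false

noncomputable section

/-! ### Bounded functions as an injective space -/

/-- The operator into `ℓ^∞(ι)` whose coordinates are a uniformly bounded family of functionals. -/
def familyToLinfty {ι V : Type*} [NormedAddCommGroup V] [NormedSpace ℂ V]
    (g : ι → V →L[ℂ] ℂ) (C : ℝ) (hg : ∀ i, ‖g i‖ ≤ C) (hC : 0 ≤ C) :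
    V →L[ℂ] lp (fun _ : ι => ℂ) ∞ :=
  LinearMap.mkContinuous
    { toFun := fun x => ⟨fun i => g i x, memℓp_infty ⟨C * ‖x‖, by
        rintro _ ⟨i, rfl⟩
        exact (g i).le_of_opNorm_le (hg i) x⟩⟩
      map_add' := fun x y => by ext i; exact map_add (g i) x y
      map_smul' := fun c x => by ext i; exact map_smul (g i) c x }
    C
    (fun x => lp.norm_le_of_forall_le (by positivity) fun i => (g i).le_of_opNorm_le (hg i) x)

theorem familyToLinfty_apply {ι V : Type*} [NormedAddCommGroup V] [NormedSpace ℂ V]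
    (g : ι → V →L[ℂ] ℂ) (C : ℝ) (hg : ∀ i, ‖g i‖ ≤ C) (hC : 0 ≤ C) (x : V) (i : ι) :
    familyToLinfty g C hg hC x i = g i x := rfl

theorem norm_familyToLinfty_le {ι V : Type*} [NormedAddCommGroup V] [NormedSpace ℂ V]
    (g : ι → V →L[ℂ] ℂ) (C : ℝ) (hg : ∀ i, ‖g i‖ ≤ C) (hC : 0 ≤ C) :
    ‖familyToLinfty g C hg hC‖ ≤ C :=
  LinearMap.mkContinuous_norm_le _ hC _

theorem exists_extension_along_isometry {X Y : Type*} [NormedAddCommGroup X] [NormedSpace ℂ X]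
    [NormedAddCommGroup Y] [NormedSpace ℂ Y] (I : X →ₗᵢ[ℂ] Y) (φ : X →L[ℂ] ℂ) :
    ∃ M : Y →L[ℂ] ℂ, (∀ x, M (I x) = φ x) ∧ ‖M‖ ≤ ‖φ‖ := by
  let e : X ≃ₗᵢ[ℂ] LinearMap.range I.toLinearMap := I.equivRange
  obtain ⟨M, hM, hMn⟩ := exists_extension_norm_eq (LinearMap.range I.toLinearMap)
    (φ.comp (e.symm.toContinuousLinearEquiv : _ →L[ℂ] X))
  refine ⟨M, fun x => ?_, ?_⟩
  · refine (hM (e x)).trans ?_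
    change φ (e.symm (e x)) = _
    rw [e.symm_apply_apply]
  · rw [hMn]
    refine ContinuousLinearMap.opNorm_le_bound _ (norm_nonneg φ) fun y => ?_
    change ‖φ (e.symm y)‖ ≤ _
    simpa using φ.le_opNorm (e.symm y)

/-- `ℓ^∞(ι)` is an injective Banach space: apply the Hahn–Banach theorem in each coordinate. -/
theorem exists_extension_linfty {ι V : Type*} [NormedAddCommGroup V] [NormedSpace ℂ V]
    (p : Submodule ℂ V) (T : p →L[ℂ] lp (fun _ : ι => ℂ) ∞) :
    ∃ S : V →L[ℂ] lp (fun _ : ι => ℂ) ∞, (∀ x : p, S x = T x) ∧ ‖S‖ ≤ ‖T‖ := by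
  have hcoord : ∀ i x, ‖(T x : ι → ℂ) i‖ ≤ ‖T‖ * ‖x‖ := fun i x =>
    (lp.norm_apply_le_norm ENNReal.top_ne_zero _ i).trans (T.le_opNorm x)
  let c : ι → p →L[ℂ] ℂ := fun i => LinearMap.mkContinuous
    { toFun := fun x => (T x : ι → ℂ) i
      map_add' := fun x y => by simp
      map_smul' := fun a x => by simp } ‖T‖ (hcoord i)
  have hc : ∀ i, ‖c i‖ ≤ ‖T‖ := fun i => LinearMap.mkContinuous_norm_le _ (norm_nonneg T) _
  choose g hg hgn using fun i => exists_extension_norm_eq p (c i)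
  refine ⟨familyToLinfty g ‖T‖ (fun i => (hgn i).trans_le (hc i)) (norm_nonneg T), fun x => ?_,
    norm_familyToLinfty_le _ _ _ _⟩
  ext i
  rw [familyToLinfty_apply, hg]
  rfl

/-- A separable space embeds isometrically in `ℓ^∞(ℕ)`, by functionals norming a dense sequence. -/
theorem exists_isometry_linfty_nat (X : Type*) [NormedAddCommGroup X] [NormedSpace ℂ X]
    [TopologicalSpace.SeparableSpace X] : Nonempty (X →ₗᵢ[ℂ] lp (fun _ : ℕ => ℂ) ∞) := by
  choose g hg hgx using fun n => exists_dual_vector'' ℂ (TopologicalSpace.denseSeq X n)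
  refine ⟨⟨(familyToLinfty g 1 hg zero_le_one).toLinearMap, fun x => ?_⟩⟩
  change ‖familyToLinfty g 1 hg zero_le_one x‖ = ‖x‖
  apply le_antisymm
  · simpa using (familyToLinfty g 1 hg zero_le_one).le_of_opNorm_le
      (norm_familyToLinfty_le _ _ _ _) x
  · refine le_of_forall_pos_le_add fun ε hε => ?_
    obtain ⟨n, hn⟩ := Metric.denseRange_iff.1 (TopologicalSpace.denseRange_denseSeq X) x (ε / 2)
      (half_pos hε)
    rw [dist_eq_norm] at hn
    set z := TopologicalSpace.denseSeq X n with hz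
    have h1 : ‖g n x‖ ≤ ‖familyToLinfty g 1 hg zero_le_one x‖ :=
      lp.norm_apply_le_norm ENNReal.top_ne_zero (familyToLinfty g 1 hg zero_le_one x) n
    have h2 : ‖g n z‖ = ‖z‖ := by rw [hz, hgx]; simp
    have h3 : ‖g n z‖ - ‖g n x‖ ≤ ‖x - z‖ := by
      have := (g n).le_of_opNorm_le (hg n) (z - x)
      rw [map_sub, one_mul, norm_sub_rev z x] at this
      exact (norm_sub_norm_le _ _).trans this
    have h4 : ‖x‖ ≤ ‖x - z‖ + ‖z‖ := by simpa using norm_add_le (x - z) z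
    linarith

/-- A unital functional of norm at most one on `ℓ^∞(ι)` is monotone on moduli. To bound `F k`,
rotate `k` so that `F k` is a nonnegative real; then `k + (‖v‖ - v)` has norm at most `‖v‖`, and so
has its image. -/
theorem norm_apply_le_re_of_norm_le {ι : Type*} (F : lp (fun _ : ι => ℂ) ∞ →L[ℂ] ℂ)
    (hF : ‖F‖ ≤ 1) (hF1 : F 1 = 1) (k v : lp (fun _ : ι => ℂ) ∞)
    (r : ι → ℝ) (hv : ∀ i, v i = r i) (hkr : ∀ i, ‖k i‖ ≤ r i) : ‖F k‖ ≤ (F v).re := by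
  obtain ⟨c, hc, hck⟩ : ∃ c : ℂ, ‖c‖ = 1 ∧ c * F k = ‖F k‖ := by
    by_cases h : F k = 0
    · exact ⟨1, by simp, by simp [h]⟩
    · have hn : (‖F k‖ : ℂ) ≠ 0 := by simpa using h
      refine ⟨‖F k‖ / F k, by simp [h], by field_simp⟩
  have hbound : ‖c • k + ((‖v‖ : ℂ) • (1 : lp (fun _ : ι => ℂ) ∞) - v)‖ ≤ ‖v‖ := by
    refine lp.norm_le_of_forall_le (norm_nonneg _) fun i => ?_
    have hvi : r i ≤ ‖v‖ := by
      have := lp.norm_apply_le_norm ENNReal.top_ne_zero v i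
      rw [hv, Complex.norm_real] at this
      exact (le_abs_self _).trans this
    have hsplit : (c • k + ((‖v‖ : ℂ) • (1 : lp (fun _ : ι => ℂ) ∞) - v)) i
        = c * k i + ((‖v‖ - r i : ℝ) : ℂ) := by
      change c * k i + ((‖v‖ : ℂ) * (1 : lp (fun _ : ι => ℂ) ∞) i - v i) = _
      rw [hv, lp.infty_coeFn_one, Pi.one_apply, mul_one, Complex.ofReal_sub]
    rw [hsplit]
    refine (norm_add_le _ _).trans ?_
    rw [norm_mul, hc, one_mul, Complex.norm_real, Real.norm_of_nonneg (sub_nonneg.2 hvi)]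
    linarith [hkr i]
  have hval : F (c • k + ((‖v‖ : ℂ) • (1 : lp (fun _ : ι => ℂ) ∞) - v))
      = ((‖F k‖ + ‖v‖ : ℝ) : ℂ) - F v := by
    rw [map_add, map_sub, map_smul, map_smul, hF1, smul_eq_mul, hck]
    push_cast
    simp only [smul_eq_mul, mul_one]
    ring
  have h := (Complex.re_le_norm _).trans ((F.le_of_opNorm_le hF _).trans_eq (one_mul _))|>.trans
    hbound
  rw [hval, Complex.sub_re, Complex.ofReal_re] at h
  linarith

/-! ### Comparison of projection constants -/

theorem relProjConst_le_ofReal {Y : Type*} [NormedAddCommGroup Y] [NormedSpace ℂ Y]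
    {X : Submodule ℂ Y} (P : Y →L[ℂ] X) (hP : ∀ x : X, P (x : Y) = x) {C : ℝ} (hC : ‖P‖ ≤ C) :
    relProjConst X ≤ ENNReal.ofReal C :=
  (iInf₂_le P hP).trans (ENNReal.ofReal_le_ofReal hC)

/-- A space that is a retract of some `ℓ^∞(ι)`, the embedding being a contraction and the retraction
of norm at most `C`, has projection constant at most `C`. -/
theorem projConst_le_of_retract {ι : Type*} {X : Type u} [NormedAddCommGroup X] [NormedSpace ℂ X]
    (J : X →L[ℂ] lp (fun _ : ι => ℂ) ∞) (hJ : ‖J‖ ≤ 1)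
    (R : lp (fun _ : ι => ℂ) ∞ →L[ℂ] X) (hRJ : ∀ x, R (J x) = x) {C : ℝ} (hC : ‖R‖ ≤ C) :
    projConst.{w, u} X ≤ ENNReal.ofReal C := by
  refine iSup_le fun Y => iSup_le fun _ => iSup_le fun _ => iSup_le fun _ => iSup_le fun I =>
    iSup_le fun _ => ?_
  let e : X ≃ₗᵢ[ℂ] LinearMap.range I.toLinearMap := I.equivRange
  obtain ⟨S, hS, hSn⟩ := exists_extension_linfty (LinearMap.range I.toLinearMap)
    (J.comp (e.symm.toContinuousLinearEquiv : _ →L[ℂ] X))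
  have hS1 : ‖S‖ ≤ 1 := hSn.trans (ContinuousLinearMap.opNorm_le_bound _ zero_le_one fun y => by
    simpa using J.le_of_opNorm_le hJ (e.symm y))
  refine relProjConst_le_ofReal ((e.toContinuousLinearEquiv : X →L[ℂ] _).comp (R.comp S))
    (fun y => ?_) (ContinuousLinearMap.opNorm_le_bound _ ((norm_nonneg _).trans hC) fun y => ?_)
  · change e (R (S y)) = y
    rw [hS]
    change e (R (J (e.symm y))) = y
    rw [hRJ, e.apply_symm_apply]
  · change ‖e (R (S y))‖ ≤ C * ‖y‖
    rw [e.norm_map]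
    calc ‖R (S y)‖ ≤ C * ‖S y‖ := R.le_of_opNorm_le hC _
      _ ≤ C * ‖y‖ := by
        have := S.le_of_opNorm_le hS1 y
        rw [one_mul] at this
        exact mul_le_mul_of_nonneg_left this ((norm_nonneg _).trans hC)

/-- The projection constant of a finite-dimensional space dominates all its relative projection
constants, in whatever universe the ambient spaces are taken: a copy of `ℓ^∞(ℕ)` lives in every
universe, contains the space isometrically, and is injective. -/
theorem relProjConst_le_projConst {V : Type u} [NormedAddCommGroup V] [NormedSpace ℂ V]
    (X : Submodule ℂ V) [FiniteDimensional ℂ X] : relProjConst X ≤ projConst.{w, u} X := by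
  have : ProperSpace X := FiniteDimensional.proper ℂ X
  obtain ⟨I₀⟩ := exists_isometry_linfty_nat X
  let l := LinearIsometryEquiv.ulift.{0, 0, w} ℂ (lp (fun _ : ℕ => ℂ) ∞)
  let I : X →ₗᵢ[ℂ] ULift.{w} (lp (fun _ : ℕ => ℂ) ∞) := l.symm.toLinearIsometry.comp I₀
  have : FiniteDimensional ℂ (LinearMap.range I.toLinearMap) := inferInstance
  have hcompl : (LinearMap.range I.toLinearMap).ClosedComplemented :=
    Submodule.ClosedComplemented.of_finiteDimensional _
  refine le_trans ?_ (le_iSup_of_le (ULift.{w} (lp (fun _ : ℕ => ℂ) ∞)) (le_iSup_of_le _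
    (le_iSup_of_le _ (le_iSup_of_le inferInstance (le_iSup_of_le I (le_iSup_of_le hcompl le_rfl))))))
  obtain ⟨S, hS, hSn⟩ := exists_extension_linfty X I₀.toContinuousLinearMap
  have hS1 : ‖S‖ ≤ 1 := hSn.trans I₀.norm_toContinuousLinearMap_le
  let e : X ≃ₗᵢ[ℂ] LinearMap.range I.toLinearMap := I.equivRange
  refine le_iInf₂ fun P hP => ?_
  refine relProjConst_le_ofReal ((e.symm.toContinuousLinearEquiv : _ →L[ℂ] X).comp
    (P.comp ((l.symm.toContinuousLinearEquiv : _ →L[ℂ] _).comp S))) (fun x => ?_)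
    (ContinuousLinearMap.opNorm_le_bound _ (norm_nonneg P) fun y => ?_)
  · change e.symm (P (l.symm (S x))) = x
    rw [hS]
    change e.symm (P (e x : ULift.{w} (lp (fun _ : ℕ => ℂ) ∞))) = x
    rw [hP, e.symm_apply_apply]
  · change ‖e.symm (P (l.symm (S y)))‖ ≤ ‖P‖ * ‖y‖
    rw [e.symm.norm_map]
    calc ‖P (l.symm (S y))‖ ≤ ‖P‖ * ‖l.symm (S y)‖ := P.le_opNorm _
      _ ≤ ‖P‖ * ‖y‖ := by
        have := S.le_of_opNorm_le hS1 y
        rw [one_mul] at this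
        rw [l.symm.norm_map]
        exact mul_le_mul_of_nonneg_left this (norm_nonneg P)

section Group

variable {G : Type u} [CommGroup G] [TopologicalSpace G]

/-! ### Characters -/

theorem coe_char_mul (γ : PontryaginDual G) (a b : G) : (γ (a * b) : ℂ) = γ a * γ b := by
  rw [map_mul, Circle.coe_mul]

theorem coe_char_inv (γ : PontryaginDual G) (a : G) : (γ a⁻¹ : ℂ) = conj (γ a : ℂ) := by
  rw [map_inv, Circle.coe_inv_eq_conj]

theorem coe_char_mul_conj (γ : PontryaginDual G) (a : G) : (γ a : ℂ) * conj (γ a : ℂ) = 1 := by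
  rw [← Circle.coe_inv_eq_conj, ← Circle.coe_mul, mul_inv_cancel, Circle.coe_one]

theorem continuous_coe_char (γ : PontryaginDual G) : Continuous fun a => (γ a : ℂ) :=
  (charFun γ).continuous

theorem charFun_mem_trigPoly {E : Finset (PontryaginDual G)} {γ : PontryaginDual G} (hγ : γ ∈ E) :
    charFun γ ∈ trigPoly E :=
  Submodule.subset_span ⟨γ, hγ, rfl⟩

instance finiteDimensional_trigPoly (E : Finset (PontryaginDual G)) :
    FiniteDimensional ℂ (trigPoly E) :=
  FiniteDimensional.span_of_finite ℂ (E.finite_toSet.image _)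

variable [IsTopologicalGroup G] [CompactSpace G]

theorem norm_translateFun_le (a : G) (f : C(G, ℂ)) : ‖translateFun a f‖ ≤ ‖f‖ :=
  (ContinuousMap.norm_le _ (norm_nonneg _)).2 fun b => f.norm_coe_le_norm (a * b)

theorem continuous_translateFun (f : C(G, ℂ)) : Continuous fun a => translateFun a f := by
  let F : C(G × G, ℂ) := ⟨fun p => f (p.1 * p.2), by fun_prop⟩
  exact F.curry.continuous

variable [MeasurableSpace G] [BorelSpace G] (m : Measure G) [IsProbabilityMeasure m]

theorem integrable_of_continuous {V : Type*} [NormedAddCommGroup V] {h : G → V}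
    (hh : Continuous h) : Integrable h m :=
  hh.integrable_of_hasCompactSupport (HasCompactSupport.of_compactSpace h)

/-! ### Fourier coefficients and the Fourier projection -/

/-- The mean `f ↦ ∫ f dm`, as a bounded functional on `C(G)`. -/
def meanCLM : C(G, ℂ) →L[ℂ] ℂ :=
  LinearMap.mkContinuous
    { toFun := fun f => ∫ a, f a ∂m
      map_add' := fun f g => integral_add (integrable_of_continuous m f.continuous)
        (integrable_of_continuous m g.continuous)
      map_smul' := fun c f => integral_const_mul c f } 1
    (fun f => by
      simpa using norm_integral_le_of_norm_le_const (μ := m)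
        (Filter.Eventually.of_forall f.norm_coe_le_norm))

theorem norm_meanCLM_le : ‖meanCLM m‖ ≤ 1 := LinearMap.mkContinuous_norm_le _ zero_le_one _

/-- The Fourier coefficient at `γ`, as a bounded functional on `C(G)`. -/
def fourierCLM (γ : PontryaginDual G) : C(G, ℂ) →L[ℂ] ℂ :=
  (meanCLM m).comp ((ContinuousLinearMap.mul ℂ C(G, ℂ)).flip (star (charFun γ)))

theorem fourierAt_charFun_self (γ : PontryaginDual G) : fourierAt m (charFun γ) γ = 1 := by
  have h : ∀ a, charFun γ a * conj (γ a : ℂ) = 1 := coe_char_mul_conj γ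
  simp [fourierAt, h]

variable [m.IsHaarMeasure]

/-- Distinct characters are orthogonal: translating by a point where they differ multiplies the
integral by a number other than `1`. -/
theorem fourierAt_charFun_of_ne {γ γ' : PontryaginDual G} (h : γ ≠ γ') :
    fourierAt m (charFun γ) γ' = 0 := by
  obtain ⟨c, hc⟩ : ∃ c, γ c ≠ γ' c := by
    by_contra! H
    exact h (PontryaginDual.ext H)
  have key : fourierAt m (charFun γ) γ'
      = (γ c * conj (γ' c : ℂ)) * fourierAt m (charFun γ) γ' := by
    unfold fourierAt
    rw [← integral_const_mul, ← integral_mul_left_eq_self _ c]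
    refine integral_congr_ae (Filter.Eventually.of_forall fun a => ?_)
    change (γ (c * a) : ℂ) * conj (γ' (c * a) : ℂ) = γ c * conj (γ' c : ℂ) * (γ a * conj (γ' a : ℂ))
    rw [coe_char_mul, coe_char_mul, map_mul]
    ring
  have hne : (γ c * conj (γ' c : ℂ) : ℂ) ≠ 1 := fun h1 => by
    refine hc (Circle.ext ?_)
    calc (γ c : ℂ) = γ c * conj (γ' c : ℂ) * γ' c := by
          rw [mul_assoc, mul_comm (conj _), coe_char_mul_conj, mul_one]
      _ = γ' c := by rw [h1, one_mul]
  have h0 : (1 - γ c * conj (γ' c : ℂ)) * fourierAt m (charFun γ) γ' = 0 := by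
    rw [sub_mul, one_mul, ← key, sub_self]
  exact (mul_eq_zero.1 h0).resolve_left (sub_ne_zero.2 hne.symm)

variable (E : Finset (PontryaginDual G))

theorem fourierProj_charFun {γ : PontryaginDual G} (hγ : γ ∈ E) :
    fourierProj m E (charFun γ) = charFun γ := by
  rw [fourierProj_apply, Finset.sum_eq_single_of_mem γ hγ fun γ' _ h => by
    rw [fourierAt_charFun_of_ne m h.symm, zero_smul], fourierAt_charFun_self, one_smul]

theorem fourierProj_of_mem {f : C(G, ℂ)} (hf : f ∈ trigPoly E) : fourierProj m E f = f := by
  induction hf using Submodule.span_induction with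
  | mem x hx =>
    obtain ⟨γ, hγ, rfl⟩ := hx
    exact fourierProj_charFun m E hγ
  | zero => exact map_zero _
  | add x y _ _ hx hy => rw [map_add, hx, hy]
  | smul a x _ hx => rw [map_smul, hx]

theorem isProj_fourierProj : LinearMap.IsProj (trigPoly E) (fourierProj m E) where
  map_mem _ := Submodule.sum_mem _ fun _ hγ => Submodule.smul_mem _ _ (charFun_mem_trigPoly hγ)
  map_id _ hf := fourierProj_of_mem m E hf

/-- Vector-valued form of the Fourier coefficient: the average of the translates of `f` against
`conj γ` is the `γ`-component of `f`. -/
theorem integral_conj_smul_translateFun (f : C(G, ℂ)) (γ : PontryaginDual G) :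
    ∫ a, conj (γ a : ℂ) • translateFun a f ∂m = fourierAt m f γ • charFun γ := by
  have hint : Integrable (fun a => conj (γ a : ℂ) • translateFun a f) m :=
    integrable_of_continuous m ((Complex.continuous_conj.comp (continuous_coe_char γ)).smul
      (continuous_translateFun f))
  ext b
  have h := (ContinuousMap.evalCLM ℂ b).integral_comp_comm hint
  rw [ContinuousMap.evalCLM_apply] at h
  rw [← h]
  change ∫ a, conj (γ a : ℂ) * f (a * b) ∂m = fourierAt m f γ * γ b
  unfold fourierAt
  rw [← integral_mul_const, ← integral_mul_right_eq_self (fun a => f a * conj (γ a : ℂ) * γ b) b]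
  refine integral_congr_ae (Filter.Eventually.of_forall fun a => ?_)
  change conj (γ a : ℂ) * f (a * b) = f (a * b) * conj (γ (a * b) : ℂ) * γ b
  rw [coe_char_mul, map_mul (starRingEnd ℂ)]
  linear_combination (-(conj (γ a : ℂ) * f (a * b))) * coe_char_mul_conj γ b

/-- Averaging the conjugates of any bounded projection onto `Trig_E(G)` by the translations gives
the Fourier projection. -/
theorem fourierProj_eq_average {P : C(G, ℂ) →L[ℂ] C(G, ℂ)} (hP : LinearMap.IsProj (trigPoly E) P)
    (f : C(G, ℂ)) (b : G) :
    fourierProj m E f b = ∫ a, P (translateFun a f) (a⁻¹ * b) ∂m := by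
  let L : PontryaginDual G → C(G, ℂ) →L[ℂ] ℂ := fun γ => (fourierCLM m γ).comp P
  have hcont : ∀ γ : PontryaginDual G,
      Continuous fun a => conj (γ a : ℂ) • translateFun a f := fun γ =>
    (Complex.continuous_conj.comp (continuous_coe_char γ)).smul (continuous_translateFun f)
  have hL : ∀ γ ∈ E, ∫ a, L γ (conj (γ a : ℂ) • translateFun a f) ∂m = fourierAt m f γ := by
    intro γ hγ
    rw [(L γ).integral_comp_comm (integrable_of_continuous m (hcont γ)),
      integral_conj_smul_translateFun, map_smul]
    change _ • fourierAt m (P (charFun γ)) γ = _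
    rw [hP.map_id _ (charFun_mem_trigPoly hγ), fourierAt_charFun_self, smul_eq_mul, mul_one]
  have hexp : ∀ a, P (translateFun a f) (a⁻¹ * b)
      = ∑ γ ∈ E, L γ (conj (γ a : ℂ) • translateFun a f) * γ b := by
    intro a
    rw [← fourierProj_of_mem m E (hP.map_mem (translateFun a f)), fourierProj_apply,
      ContinuousMap.sum_apply]
    refine Finset.sum_congr rfl fun γ _ => ?_
    rw [map_smul]
    change fourierAt m (P (translateFun a f)) γ * (γ (a⁻¹ * b) : ℂ)
      = conj (γ a : ℂ) * fourierAt m (P (translateFun a f)) γ * γ b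
    rw [coe_char_mul, coe_char_inv]
    ring
  have hint : ∀ γ ∈ E,
      Integrable (fun a => L γ (conj (γ a : ℂ) • translateFun a f) * (γ b : ℂ)) m := fun γ _ =>
    (integrable_of_continuous m ((L γ).continuous.comp (hcont γ))).mul_const _
  rw [integral_congr_ae (Filter.Eventually.of_forall hexp), integral_finsetSum E hint,
    fourierProj_apply, ContinuousMap.sum_apply]
  refine Finset.sum_congr rfl fun γ hγ => ?_
  rw [integral_mul_const, hL γ hγ]
  rfl

theorem norm_fourierProj_le_of_isProj {P : C(G, ℂ) →L[ℂ] C(G, ℂ)}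
    (hP : LinearMap.IsProj (trigPoly E) P) : ‖fourierProj m E‖ ≤ ‖P‖ := by
  refine ContinuousLinearMap.opNorm_le_bound _ (norm_nonneg P) fun f => ?_
  refine (ContinuousMap.norm_le _ (by positivity)).2 fun b => ?_
  rw [fourierProj_eq_average m E hP]
  have h : ∀ a, ‖P (translateFun a f) (a⁻¹ * b)‖ ≤ ‖P‖ * ‖f‖ := fun a =>
    ((P (translateFun a f)).norm_coe_le_norm _).trans ((P.le_opNorm _).trans
      (mul_le_mul_of_nonneg_left (norm_translateFun_le a f) (norm_nonneg P)))
  simpa using norm_integral_le_of_norm_le_const (μ := m) (Filter.Eventually.of_forall h)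

theorem fourierProj_translateFun (a : G) (f : C(G, ℂ)) :
    fourierProj m E (translateFun a f) = translateFun a (fourierProj m E f) := by
  have h : ∀ γ : PontryaginDual G, fourierAt m (translateFun a f) γ = γ a * fourierAt m f γ := by
    intro γ
    unfold fourierAt
    rw [← integral_const_mul, ← integral_mul_left_eq_self (fun b => γ a * (f b * conj (γ b : ℂ))) a]
    refine integral_congr_ae (Filter.Eventually.of_forall fun b => ?_)
    change f (a * b) * conj (γ b : ℂ) = γ a * (f (a * b) * conj (γ (a * b) : ℂ))
    rw [coe_char_mul, map_mul (starRingEnd ℂ)]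
    linear_combination (-(f (a * b) * conj (γ b : ℂ))) * coe_char_mul_conj γ a
  ext b
  change fourierProj m E (translateFun a f) b = fourierProj m E f (a * b)
  rw [fourierProj_apply, fourierProj_apply, ContinuousMap.sum_apply, ContinuousMap.sum_apply]
  refine Finset.sum_congr rfl fun γ _ => ?_
  change fourierAt m (translateFun a f) γ * (γ b : ℂ) = fourierAt m f γ * (γ (a * b) : ℂ)
  rw [h, coe_char_mul]
  ring

theorem eq_fourierProj_of_commute {Q : C(G, ℂ) →L[ℂ] C(G, ℂ)}
    (hQ : LinearMap.IsProj (trigPoly E) Q)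
    (hcomm : ∀ (a : G) (f : C(G, ℂ)), Q (translateFun a f) = translateFun a (Q f)) :
    Q = fourierProj m E := by
  ext f b
  have h : ∀ a, Q (translateFun a f) (a⁻¹ * b) = Q f b := fun a => by
    rw [hcomm]
    exact congrArg (Q f) (mul_inv_cancel_left a b)
  rw [fourierProj_eq_average m E hQ]
  simp [h]

theorem relProjConst_trigPoly :
    relProjConst (trigPoly E) = ENNReal.ofReal ‖fourierProj m E‖ := by
  apply le_antisymm
  · refine relProjConst_le_ofReal
      ((fourierProj m E).codRestrict (trigPoly E) (isProj_fourierProj m E).map_mem)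
      (fun x => Subtype.ext ((isProj_fourierProj m E).map_id x x.2))
      (ContinuousLinearMap.opNorm_le_bound _ (norm_nonneg (fourierProj m E))
        (fourierProj m E).le_opNorm)
  · refine le_iInf₂ fun P hP => ENNReal.ofReal_le_ofReal ?_
    refine (norm_fourierProj_le_of_isProj m E (P := (trigPoly E).subtypeL.comp P)
      ⟨fun f => (P f).2, fun f hf => congrArg Subtype.val (hP ⟨f, hf⟩)⟩).trans ?_
    exact ContinuousLinearMap.opNorm_le_bound _ (norm_nonneg P) P.le_opNorm

/-! ### The norm of the Fourier projection -/

theorem norm_sum_char_inv_mul (a b : G) :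
    ‖∑ γ ∈ E, conj (γ a : ℂ) * (γ b : ℂ)‖ = ‖∑ γ ∈ E, (γ (b⁻¹ * a) : ℂ)‖ := by
  rw [← RCLike.norm_conj (∑ γ ∈ E, (γ (b⁻¹ * a) : ℂ)), map_sum]
  congr 1
  refine Finset.sum_congr rfl fun γ _ => ?_
  rw [coe_char_mul, coe_char_inv, map_mul, Complex.conj_conj, mul_comm]

/-- Testing `Π` at the identity on `D / (|D| + ε)`, where `D = ∑ γ ∈ E, γ`, a continuous substitute
for the phase of `D`. -/
theorem integral_norm_sum_le_norm_fourierProj :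
    ∫ a, ‖∑ γ ∈ E, (γ a : ℂ)‖ ∂m ≤ ‖fourierProj m E‖ := by
  set D : G → ℂ := fun a => ∑ γ ∈ E, (γ a : ℂ) with hD
  have hDc : Continuous D := continuous_finsetSum _ fun γ _ => continuous_coe_char γ
  refine le_of_forall_pos_le_add fun ε hε => ?_
  have hpos : ∀ a, 0 < ‖D a‖ + ε := fun a => by positivity
  let f : C(G, ℂ) := ⟨fun a => D a / ((‖D a‖ + ε : ℝ) : ℂ),
    hDc.div (by fun_prop) fun a => Complex.ofReal_ne_zero.2 (hpos a).ne'⟩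
  have hfn : ‖f‖ ≤ 1 := (ContinuousMap.norm_le _ zero_le_one).2 fun a => by
    change ‖D a / ((‖D a‖ + ε : ℝ) : ℂ)‖ ≤ 1
    rw [norm_div, Complex.norm_real, Real.norm_of_nonneg (hpos a).le, div_le_one (hpos a)]
    linarith
  have hval : fourierProj m E f 1 = ((∫ a, ‖D a‖ ^ 2 / (‖D a‖ + ε) ∂m : ℝ) : ℂ) := by
    rw [fourierProj_apply, ContinuousMap.sum_apply, ← integral_complex_ofReal]
    have h1 : ∀ γ ∈ E, (fourierAt m f γ • charFun γ) 1 = ∫ a, f a * conj (γ a : ℂ) ∂m := by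
      intro γ _
      change fourierAt m f γ * (γ 1 : ℂ) = _
      rw [map_one, Circle.coe_one, mul_one]
      rfl
    rw [Finset.sum_congr rfl h1, ← integral_finsetSum _ fun γ _ => integrable_mul_conj m f γ]
    refine integral_congr_ae (Filter.Eventually.of_forall fun a => ?_)
    change ∑ γ ∈ E, f a * conj (γ a : ℂ) = _
    rw [← Finset.mul_sum, ← map_sum]
    change D a / ((‖D a‖ + ε : ℝ) : ℂ) * conj (D a) = _
    rw [div_mul_eq_mul_div, Complex.mul_conj, Complex.normSq_eq_norm_sq]
    push_cast
    rfl
  have hle : ∫ a, ‖D a‖ ^ 2 / (‖D a‖ + ε) ∂m ≤ ‖fourierProj m E‖ := by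
    calc ∫ a, ‖D a‖ ^ 2 / (‖D a‖ + ε) ∂m ≤ ‖fourierProj m E f 1‖ := by
          rw [hval, Complex.norm_real]
          exact le_abs_self _
      _ ≤ ‖fourierProj m E f‖ := ContinuousMap.norm_coe_le_norm _ _
      _ ≤ ‖fourierProj m E‖ * ‖f‖ := (fourierProj m E).le_opNorm f
      _ ≤ ‖fourierProj m E‖ := mul_le_of_le_one_right (norm_nonneg (fourierProj m E)) hfn
  have hc : Continuous fun a => ‖D a‖ ^ 2 / (‖D a‖ + ε) :=
    (hDc.norm.pow 2).div (by fun_prop) fun a => (hpos a).ne'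
  calc ∫ a, ‖D a‖ ∂m ≤ ∫ a, (‖D a‖ ^ 2 / (‖D a‖ + ε) + ε) ∂m := by
        refine integral_mono (integrable_of_continuous m hDc.norm)
          (integrable_of_continuous m (hc.add continuous_const)) fun a => ?_
        change ‖D a‖ ≤ ‖D a‖ ^ 2 / (‖D a‖ + ε) + ε
        rw [← sub_le_iff_le_add, le_div_iff₀ (hpos a)]
        nlinarith [sq_nonneg ε]
    _ = ∫ a, ‖D a‖ ^ 2 / (‖D a‖ + ε) ∂m + ε := by
        rw [integral_add (integrable_of_continuous m hc) (integrable_const ε)]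
        simp
    _ ≤ ‖fourierProj m E‖ + ε := by gcongr

/-- `C(G)` sits isometrically in the space `ℓ^∞(G)` of all bounded functions. -/
def toLinfty : C(G, ℂ) →ₗᵢ[ℂ] lp (fun _ : G => ℂ) ∞ where
  toFun f := ⟨fun a => f a, memℓp_infty ⟨‖f‖, by
    rintro _ ⟨a, rfl⟩
    exact f.norm_coe_le_norm a⟩⟩
  map_add' f g := by ext; rfl
  map_smul' c f := by ext; rfl
  norm_map' f := le_antisymm
    (lp.norm_le_of_forall_le (norm_nonneg _) f.norm_coe_le_norm)
    ((ContinuousMap.norm_le _ (norm_nonneg _)).2 fun a =>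
      lp.norm_apply_le_norm (E := fun _ : G => ℂ) ENNReal.top_ne_zero ⟨fun a => f a, _⟩ a)

theorem toLinfty_apply (f : C(G, ℂ)) (a : G) : toLinfty f a = f a := rfl

theorem exists_mean_linfty : ∃ M : lp (fun _ : G => ℂ) ∞ →L[ℂ] ℂ,
    (∀ f : C(G, ℂ), M (toLinfty f) = ∫ a, f a ∂m) ∧ ‖M‖ ≤ 1 := by
  obtain ⟨M, hM, hMn⟩ := exists_extension_along_isometry toLinfty (meanCLM m)
  exact ⟨M, hM, hMn.trans (norm_meanCLM_le m)⟩

/-- Replacing the Haar integral by a norm-one extension to all bounded functions, the formula for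
`Π` defines an operator on `ℓ^∞(G)` whose norm is still at most the `L¹` norm of the kernel. -/
theorem exists_fourierProj_linfty :
    ∃ R : lp (fun _ : G => ℂ) ∞ →L[ℂ] trigPoly E,
      (∀ f : C(G, ℂ), (R (toLinfty f) : C(G, ℂ)) = fourierProj m E f) ∧
      ‖R‖ ≤ ∫ a, ‖∑ γ ∈ E, (γ a : ℂ)‖ ∂m := by
  obtain ⟨M, hM, hMn⟩ := exists_mean_linfty m
  have hM1 : M 1 = 1 := by
    have h1 : (1 : lp (fun _ : G => ℂ) ∞) = toLinfty 1 := rfl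
    rw [h1, hM]
    simp
  let R : lp (fun _ : G => ℂ) ∞ →L[ℂ] trigPoly E := ∑ γ ∈ E.attach,
    (M.comp ((ContinuousLinearMap.mul ℂ (lp (fun _ : G => ℂ) ∞)).flip
      (toLinfty (star (charFun γ.1))))).smulRight
      (⟨charFun γ.1, charFun_mem_trigPoly γ.2⟩ : trigPoly E)
  have hR : ∀ k, (R k : C(G, ℂ)) = ∑ γ ∈ E, M (k * toLinfty (star (charFun γ))) • charFun γ := by
    intro k
    rw [← Finset.sum_attach E fun γ => M (k * toLinfty (star (charFun γ))) • charFun γ]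
    simp [R, mul_comm]
  refine ⟨R, fun f => ?_, ContinuousLinearMap.opNorm_le_bound _
    (integral_nonneg fun a => norm_nonneg _) fun k => ?_⟩
  · rw [hR, fourierProj_apply]
    refine Finset.sum_congr rfl fun γ _ => ?_
    have h1 : toLinfty f * toLinfty (star (charFun γ)) = toLinfty (f * star (charFun γ)) := rfl
    rw [h1, hM]
    rfl
  · change ‖(R k : C(G, ℂ))‖ ≤ _
    refine (ContinuousMap.norm_le _ (mul_nonneg (integral_nonneg fun a => norm_nonneg _)
      (norm_nonneg _))).2 fun b => ?_
    -- the kernel of `Π` at the point `b`, and its modulus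
    let K : C(G, ℂ) := ∑ γ ∈ E, (γ b : ℂ) • star (charFun γ)
    let N : C(G, ℂ) := ⟨fun a => ((‖k‖ * ‖K a‖ : ℝ) : ℂ), by fun_prop⟩
    have hK : ∀ a, ‖K a‖ = ‖∑ γ ∈ E, (γ (b⁻¹ * a) : ℂ)‖ := fun a => by
      rw [← norm_sum_char_inv_mul, ContinuousMap.sum_apply]
      congr 1
      exact Finset.sum_congr rfl fun γ _ => mul_comm _ _
    have hRb : (R k : C(G, ℂ)) b = M (k * toLinfty K) := by
      rw [hR, ContinuousMap.sum_apply, map_sum, Finset.mul_sum, map_sum]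
      refine Finset.sum_congr rfl fun γ _ => ?_
      rw [map_smul, mul_smul_comm, map_smul, smul_eq_mul]
      exact mul_comm _ _
    have hbd := norm_apply_le_re_of_norm_le M hMn hM1 (k * toLinfty K) (toLinfty N)
      (fun a => ‖k‖ * ‖K a‖) (fun a => rfl) fun a => by
        rw [lp.infty_coeFn_mul, Pi.mul_apply, toLinfty_apply, norm_mul]
        exact mul_le_mul_of_nonneg_right (lp.norm_apply_le_norm ENNReal.top_ne_zero k a)
          (norm_nonneg _)
    rw [hRb]
    refine hbd.trans_eq ?_
    have hN : M (toLinfty N) = ((∫ a, ‖k‖ * ‖K a‖ ∂m : ℝ) : ℂ) := by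
      rw [hM, ← integral_complex_ofReal]
      rfl
    rw [hN, Complex.ofReal_re, integral_const_mul, mul_comm]
    simp_rw [hK]
    rw [integral_mul_left_eq_self fun a => ‖∑ γ ∈ E, (γ a : ℂ)‖]

theorem norm_fourierProj : ‖fourierProj m E‖ = ∫ a, ‖∑ γ ∈ E, (γ a : ℂ)‖ ∂m := by
  obtain ⟨R, hR, hRn⟩ := exists_fourierProj_linfty m E
  refine le_antisymm (ContinuousLinearMap.opNorm_le_bound _
    (integral_nonneg fun a => norm_nonneg _) fun f => ?_)
    (integral_norm_sum_le_norm_fourierProj m E)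
  rw [← hR, ← toLinfty.norm_map f]
  exact R.le_of_opNorm_le hRn _

theorem projConst_trigPoly :
    projConst.{w, u} (trigPoly E) = ENNReal.ofReal ‖fourierProj m E‖ := by
  apply le_antisymm
  · obtain ⟨R, hR, hRn⟩ := exists_fourierProj_linfty m E
    refine projConst_le_of_retract
      ((toLinfty (G := G)).comp (trigPoly E).subtypeₗᵢ).toContinuousLinearMap
      (LinearIsometry.norm_toContinuousLinearMap_le _) R (fun x => Subtype.ext ?_)
      (hRn.trans_eq (norm_fourierProj m E).symm)
    exact (hR x).trans (fourierProj_of_mem m E x.2)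
  · rw [← relProjConst_trigPoly]
    exact relProjConst_le_projConst _

end Group

end

theorem theorem1p1 {G : Type u} [CommGroup G] [TopologicalSpace G] [IsTopologicalGroup G]
    [CompactSpace G] [MeasurableSpace G] [BorelSpace G]
    (m : Measure G) [m.IsHaarMeasure] [IsProbabilityMeasure m]
    (E : Finset (PontryaginDual G)) :
    -- `Π` is a projection of `C(G)` onto `Trig_E(G)` that commutes with all translations
    (LinearMap.IsProj (trigPoly E) (fourierProj m E) ∧
      ∀ (a : G) (f : C(G, ℂ)), fourierProj m E (translateFun a f) = translateFun a (fourierProj m E f)) ∧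
    -- and it is the only one
    (∀ Q : C(G, ℂ) →L[ℂ] C(G, ℂ), LinearMap.IsProj (trigPoly E) Q →
      (∀ (a : G) (f : C(G, ℂ)), Q (translateFun a f) = translateFun a (Q f)) → Q = fourierProj m E) ∧
    -- it is a minimal projection of `C(G)` onto `Trig_E(G)`
    relProjConst (trigPoly E) = ENNReal.ofReal ‖fourierProj m E‖ ∧
    -- its norm is the absolute projection constant of `Trig_E(G)`
    projConst.{w, u} (trigPoly E) = ENNReal.ofReal ‖fourierProj m E‖ ∧
    -- and is given by the integral formula
    ‖fourierProj m E‖ = ∫ a, ‖∑ γ ∈ E, (γ a : ℂ)‖ ∂m := by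
  exact ⟨⟨isProj_fourierProj m E, fourierProj_translateFun m E⟩,
    fun _ hQ hcomm => eq_fourierProj_of_commute m E hQ hcomm, relProjConst_trigPoly m E,
    projConst_trigPoly m E, norm_fourierProj m E⟩
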